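/- Let $A$ be a finite alphabet, $A^*$ the free monoid on $A$, and $\widehat{A^*}$ the free profinite monoid on $A$, in which $A^*$ embeds as a dense submonoid; $\overline{Y}$ denotes the closure of $Y$ in $\widehat{A^*}$. In a monoid $M$, write $u\mathrel{\mathcal J}v$ if $MuM=MvM$, and $u\mathrel{\mathcal L}v$ if $Mu=Mv$; a maximal subgroup of $M$ is a subsemigroup of $M$ that is a group and that is maximal, with respect to inclusion, among such subsemigroups. A set $F\subseteq A^*$ is recurrent if it is nonempty, contains all factors of its elements, is not $\{1\}$, and for all $u,v\in F$ there is $w\in F$ with $uwv\in F$. For a recurrent $F$, let $J(F)$ be the minimum $\mathcal J$-class of $\widehat{A^*}$ meeting $\overline F$ (it is contained in $\overline F$, and $\overline F$ is the set of factors of its elements). For $u\in F$, the set $R_F(u)$ of first return words of $F$ to $u$ consists of the words $v\neq 1$ such that $uv\in F\cap A^*u$ and $uv\notin A^+uA^+$, where $A^+=A^*\setminus\{1\}$. Let $X$ be a rational code of $A^*$, that is, a rational set of nonempty words that freely generates the submonoid $X^*$. Let $\eta_{X^*}\colon A^*\to M(X^*)$ be the syntactic homomorphism onto the (finite) syntactic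 monoid of $X^*$, and $\hat\eta_{X^*}\colon\widehat{A^*}\to M(X^*)$ its continuous extension. Let $J_F(X)$ be the $\mathcal J$-class of $M(X^*)$ that contains $\hat\eta_{X^*}(J(F))$. The code $X$ is weakly $F$-charged if $X\subseteq F$ and $\hat\eta_{X^*}$ maps every maximal subgroup of $\widehat{A^*}$ contained in $J(F)$ onto a maximal subgroup of $M(X^*)$ contained in $J_F(X)$. Let $Q_X$ be the set of states of the minimal (trim, not necessarily complete) deterministic automaton $\mathcal M_{X^*}$ of $X^*$, on which $A^*$ and $M(X^*)$ act on the right by partial maps; for $K\subseteq M(X^*)$, let $Q_X\cdot K$ be the set of all states $q\cdot g$ with $q\in Q_X$, $g\in K$ and $q\cdot g$ defined. **Proposition.** Let $F\subseteq A^*$ be recurrent, let $X$ be a weakly $F$-charged rational code of $A^*$, let $K$ be a maximal subgroup of $M(X^*)$ contained in $J_F(X)$, and let $u\in F$ be such that $\eta_{X^*}(u)$ is $\mathcal L$-equivalent to the elements of $K$. Then every $v\in R_F(u)$ acts in $\mathcal M_{X^*}$ on $Q_X\cdot K$ as a permutation $\pi_v$ of $Q_X\cdot K$, every element of $K$ acts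 as a permutation of $Q_X\cdot K$, and the group of permutations of $Q_X\cdot K$ generated by $\{\pi_v\mid v\in R_F(u)\}$ is exactly the group of permutations of $Q_X\cdot K$ resulting from the restriction to $Q_X\cdot K$ of the action in $\mathcal M_{X^*}$ of the elements of $K$. -/

import Mathlib

/-! Words over an alphabet `A` are the elements of `FreeMonoid A`; the empty word is `1`. -/

namespace WordCode

/-! ### Green's relations and subgroups of a monoid -/

section Monoids

variable {M : Type*} [Monoid M]

/-- `u` is a factor of `v`. -/
def IsFactor (u v : M) : Prop := ∃ x y : M, v = x * u * y

/-- Green's relation `𝓙`: `u` and `v` generate the same two-sided ideal. -/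
def GreenJ (u v : M) : Prop :=
  {w : M | ∃ x y, w = x * u * y} = {w : M | ∃ x y, w = x * v * y}

/-- Green's relation `𝓛`: `u` and `v` generate the same left ideal. -/
def GreenL (u v : M) : Prop :=
  {w : M | ∃ x, w = x * u} = {w : M | ∃ x, w = x * v}

/-- A subgroup of the monoid `M`: a subsemigroup that is a group. Its neutral element `e` is an
idempotent of `M`, which need not be the neutral element of `M`. -/
def IsSubgroupOf (K : Set M) : Prop :=
  (∀ x ∈ K, ∀ y ∈ K, x * y ∈ K) ∧
    ∃ e ∈ K, (∀ x ∈ K, e * x = x ∧ x * e = x) ∧ ∀ x ∈ K, ∃ y ∈ K, x * y = e ∧ y * x = e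

/-- A maximal subgroup of the monoid `M`, with respect to inclusion. -/
def IsMaximalSubgroup (K : Set M) : Prop := Maximal IsSubgroupOf K

end Monoids

variable {A : Type*}

/-! ### Recurrent sets, first return words, codes -/

/-- `F` contains every factor of each of its elements. -/
def IsFactorial (F : Set (FreeMonoid A)) : Prop :=
  ∀ u v : FreeMonoid A, IsFactor u v → v ∈ F → u ∈ F

/-- Recurrent sets of words. -/
structure IsRecurrent (F : Set (FreeMonoid A)) : Prop where
  nonempty : F.Nonempty
  factorial : IsFactorial F
  ne_one : F ≠ {1}
  recurrent : ∀ u ∈ F, ∀ v ∈ F, ∃ w ∈ F, u * w * v ∈ F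

/-- The set `R_F(u)` of first return words of `F` to `u`: the nonempty words `v` such that `uv` is
in `F`, ends with `u`, and does not have `u` as an internal factor. -/
def firstReturns (F : Set (FreeMonoid A)) (u : FreeMonoid A) : Set (FreeMonoid A) :=
  {v | v ≠ 1 ∧ u * v ∈ F ∧ (∃ x, u * v = x * u) ∧
    ¬ ∃ x y : FreeMonoid A, x ≠ 1 ∧ y ≠ 1 ∧ u * v = x * u * y}

/-- The set `X^*` of all products of elements of `X`. -/
def kleeneStar (X : Set (FreeMonoid A)) : Set (FreeMonoid A) := (Submonoid.closure X : Set (FreeMonoid A))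

/-- `X` is a code: a set of nonempty words that freely generates the submonoid it generates. -/
def IsCode (X : Set (FreeMonoid A)) : Prop :=
  1 ∉ X ∧ Function.Injective (FreeMonoid.lift (fun x : X => (x : FreeMonoid A)))

/-- Rational languages. -/
def IsRational (L : Set (FreeMonoid A)) : Prop :=
  Language.IsRegular ({w : List A | FreeMonoid.ofList w ∈ L} : Language A)

/-- A rational code. -/
def IsRationalCode (X : Set (FreeMonoid A)) : Prop := IsCode X ∧ IsRational X

/-! ### The syntactic monoid and the minimal automaton -/

/-- The syntactic congruence of `L`: two words are congruent if they have the same contexts. -/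
def syntacticCon (L : Set (FreeMonoid A)) : Con (FreeMonoid A) where
  r u v := ∀ x y : FreeMonoid A, x * u * y ∈ L ↔ x * v * y ∈ L
  iseqv := ⟨fun _ _ _ => Iff.rfl, fun h x y => (h x y).symm,
    fun h k x y => (h x y).trans (k x y)⟩
  mul' := by
    intro u u' v v' h k x y
    have h1 := h x (v * y)
    have h2 := k (x * u') y
    simp only [mul_assoc] at h1 h2 ⊢
    exact h1.trans h2

/-- The syntactic monoid `M(L)`. -/
abbrev SyntacticMonoid (L : Set (FreeMonoid A)) : Type _ := (syntacticCon L).Quotient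

/-- The syntactic homomorphism `η_L`. -/
def eta (L : Set (FreeMonoid A)) : FreeMonoid A →* SyntacticMonoid L := (syntacticCon L).mk'

/-- The left quotient `u⁻¹L`. -/
def leftQuot (L : Set (FreeMonoid A)) (u : FreeMonoid A) : Set (FreeMonoid A) := {y | u * y ∈ L}

/-- The states of the minimal (trim, not necessarily complete) deterministic automaton of `L`: the
nonempty left quotients of `L`. -/
def MinState (L : Set (FreeMonoid A)) : Type _ :=
  {S : Set (FreeMonoid A) // S.Nonempty ∧ ∃ u, S = leftQuot L u}

open Classical in
/-- The partial action of words on the states of the minimal automaton of `L`: reading `w` in the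
state `S` leads to the state `w⁻¹S`, and is undefined (`none`) if `w⁻¹S` is empty. -/
noncomputable def wordAct (L : Set (FreeMonoid A)) (q : MinState L) (w : FreeMonoid A) :
    Option (MinState L) :=
  if h : (leftQuot q.1 w).Nonempty then
    some ⟨leftQuot q.1 w, h, by
      obtain ⟨u, hu⟩ := q.2.2
      refine ⟨u * w, ?_⟩
      rw [hu]
      ext y
      simp [leftQuot, mul_assoc]⟩
  else none

theorem wordAct_congr (L : Set (FreeMonoid A)) (q : MinState L) (w w' : FreeMonoid A)
    (h : syntacticCon L w w') : wordAct L q w = wordAct L q w' := by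
  have key : leftQuot q.1 w = leftQuot q.1 w' := by
    obtain ⟨u, hu⟩ := q.2.2
    rw [hu]
    ext y
    have := h u y
    simpa [leftQuot, mul_assoc] using this
  by_cases hn : (leftQuot q.1 w).Nonempty
  · have hn' : (leftQuot q.1 w').Nonempty := key ▸ hn
    simp only [wordAct, dif_pos hn, dif_pos hn']
    exact congrArg some (Subtype.ext key)
  · have hn' : ¬ (leftQuot q.1 w').Nonempty := key ▸ hn
    simp only [wordAct, dif_neg hn, dif_neg hn']

/-- The partial action of the syntactic monoid on the states of the minimal automaton of `L`. -/
noncomputable def act (L : Set (FreeMonoid A)) (q : MinState L) (s : SyntacticMonoid L) :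
    Option (MinState L) :=
  Con.liftOn s (wordAct L q) (fun w w' h => wordAct_congr L q w w' h)

@[simp]
theorem act_eta (L : Set (FreeMonoid A)) (q : MinState L) (w : FreeMonoid A) :
    act L q (eta L w) = wordAct L q w := rfl

/-- The set `Q · K`, where `Q` is the set of states of the minimal automaton of `L` and `K` is a
subset of the syntactic monoid of `L`. -/
def statesAct (L : Set (FreeMonoid A)) (K : Set (SyntacticMonoid L)) : Set (MinState L) :=
  {p | ∃ q : MinState L, ∃ g ∈ K, act L q g = some p}

/-- The element `s` of the syntactic monoid of `L` acts on the set `Y` of states of the minimal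
automaton of `L` as the permutation `π` of `Y`. -/
def ActsAs (L : Set (FreeMonoid A)) (Y : Set (MinState L)) (s : SyntacticMonoid L)
    (π : Equiv.Perm Y) : Prop :=
  ∀ q : Y, act L q.1 s = some (π q).1

/-! ### If `X` is rational, then the syntactic monoid of `X^*` is finite -/

theorem IsRational.finite_range_leftQuot {X : Set (FreeMonoid A)} (h : IsRational X) :
    (Set.range (leftQuot X)).Finite :=
  Language.IsRegular.finite_range_leftQuotient h

theorem kleeneStar_mul_mem (X : Set (FreeMonoid A)) {z : FreeMonoid A} (hz : z ∈ kleeneStar X) :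
    ∀ u y : FreeMonoid A, z = u * y → (u ∈ kleeneStar X ∧ y = 1) ∨
      ∃ x v y₁ y₂ : FreeMonoid A, u = x * v ∧ x ∈ kleeneStar X ∧ v * y₁ ∈ X ∧ y₂ ∈ kleeneStar X ∧
        y = y₁ * y₂ := by
  induction hz using Submonoid.closure_induction_left with
  | one =>
    intro u y h
    have h' : FreeMonoid.toList u ++ FreeMonoid.toList y = [] := h.symm
    obtain ⟨hu, hy⟩ := List.append_eq_nil_iff.1 h'
    have hu' : u = 1 := hu
    have hy' : y = 1 := hy
    exact Or.inl ⟨hu' ▸ Submonoid.one_mem (Submonoid.closure X), hy'⟩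
  | mul_left x hx z hz ih =>
    intro u y h
    have hxs : x ∈ Submonoid.closure X := Submonoid.subset_closure hx
    have h' : FreeMonoid.toList x ++ FreeMonoid.toList z =
      FreeMonoid.toList u ++ FreeMonoid.toList y := h
    have h'' : (∃ c : FreeMonoid A, u = x * c ∧ z = c * y) ∨
        ∃ c : FreeMonoid A, x = u * c ∧ y = c * z := List.append_eq_append_iff.1 h'
    rcases h'' with ⟨c, hc, hc'⟩ | ⟨c, hc, hc'⟩
    · rcases ih c y hc' with ⟨h1, h2⟩ | ⟨x', v, y₁, y₂, h1, h2, h3, h4, h5⟩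
      · exact Or.inl ⟨hc ▸ Submonoid.mul_mem _ hxs h1, h2⟩
      · exact Or.inr ⟨x * x', v, y₁, y₂, by rw [hc, h1, mul_assoc],
          Submonoid.mul_mem _ hxs h2, h3, h4, h5⟩
    · exact Or.inr ⟨1, u, c, z, (one_mul u).symm, Submonoid.one_mem (Submonoid.closure X),
        hc ▸ hx, hz, hc'⟩

theorem IsRational.finite_range_leftQuot_star {X : Set (FreeMonoid A)} (h : IsRational X) :
    (Set.range (leftQuot (kleeneStar X))).Finite := by
  have hfin : (Set.univ ×ˢ (Set.range (leftQuot X)).powerset :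
      Set (Prop × Set (Set (FreeMonoid A)))).Finite :=
    Set.finite_univ.prod h.finite_range_leftQuot.finite_subsets
  let G : Prop × Set (Set (FreeMonoid A)) → Set (FreeMonoid A) := fun p =>
    {y | (p.1 ∧ y = 1) ∨ ∃ q ∈ p.2, ∃ y₁ ∈ q, ∃ y₂ ∈ kleeneStar X, y = y₁ * y₂}
  refine (hfin.image G).subset ?_
  rintro _ ⟨u, rfl⟩
  refine ⟨(u ∈ kleeneStar X, {q | ∃ x v, u = x * v ∧ x ∈ kleeneStar X ∧ q = leftQuot X v}), ⟨trivial, ?_⟩, ?_⟩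
  · rintro q ⟨x, v, -, -, rfl⟩
    exact ⟨v, rfl⟩
  · ext y
    constructor
    · rintro (⟨h1, rfl⟩ | ⟨q, ⟨x, v, rfl, hx, rfl⟩, y₁, hy₁, y₂, hy₂, rfl⟩)
      · simpa [leftQuot] using h1
      · have h1 : v * y₁ ∈ Submonoid.closure X := Submonoid.subset_closure hy₁
        have h2 := Submonoid.mul_mem _ hx (Submonoid.mul_mem _ h1 hy₂)
        simpa [leftQuot, kleeneStar, mul_assoc] using h2
    · intro hy
      rcases kleeneStar_mul_mem X hy u y rfl with h1 | ⟨x, v, y₁, y₂, h1, h2, h3, h4, h5⟩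
      · exact Or.inl h1
      · exact Or.inr ⟨leftQuot X v, ⟨x, v, h1, h2, rfl⟩, y₁, h3, y₂, h4, h5⟩

theorem finite_syntacticMonoid {L : Set (FreeMonoid A)} (h : (Set.range (leftQuot L)).Finite) :
    Finite (SyntacticMonoid L) := by
  have := h.to_subtype
  let f : FreeMonoid A → (Set.range (leftQuot L) → Set.range (leftQuot L)) := fun w q =>
    ⟨leftQuot q.1 w, by
      obtain ⟨u, hu⟩ := q.2
      refine ⟨u * w, ?_⟩
      rw [← hu]
      ext y
      simp [leftQuot, mul_assoc]⟩
  refine Finite.of_injective (β := Set.range f)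
    (fun s => ⟨f (Function.surjInv (syntacticCon L).mk'_surjective s), ⟨_, rfl⟩⟩) ?_
  intro s t hst
  have hst' := congrArg Subtype.val hst
  rw [← Function.surjInv_eq (syntacticCon L).mk'_surjective s,
    ← Function.surjInv_eq (syntacticCon L).mk'_surjective t]
  refine (syntacticCon L).eq.2 ?_
  intro x y
  have h1 := congrArg Subtype.val (congrFun hst' ⟨leftQuot L x, x, rfl⟩)
  have h2 := Set.ext_iff.1 h1 y
  simpa [f, leftQuot, mul_assoc] using h2

theorem IsRationalCode.finite_syntacticMonoid_star {X : Set (FreeMonoid A)}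
    (hX : IsRationalCode X) : Finite (SyntacticMonoid (kleeneStar X)) :=
  finite_syntacticMonoid hX.2.finite_range_leftQuot_star

/-! ### The free profinite monoid -/

variable (A) in
/-- The congruences of finite index of the free monoid. -/
def FiniteCon : Type _ := {c : Con (FreeMonoid A) // Finite c.Quotient}

variable (A) in
/-- The families of elements of the finite quotients of the free monoid that are compatible with
the canonical projections between these quotients. -/
def compatibleFamilies : Submonoid (∀ c : FiniteCon A, c.1.Quotient) where
  carrier := {x | ∀ (c d : FiniteCon A) (h : c.1 ≤ d.1), Con.map c.1 d.1 h (x c) = x d}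
  one_mem' := fun _ _ _ => map_one _
  mul_mem' := by
    intro x y hx hy c d h
    rw [Pi.mul_apply, Pi.mul_apply, map_mul, hx c d h, hy c d h]

variable (A) in
/-- The free profinite monoid generated by `A`: the inverse limit of the finite quotients of the
free monoid generated by `A`. Its elements are the pseudowords over `A`. -/
def FreeProfiniteMonoid : Type _ := ↥(compatibleFamilies A)

noncomputable instance : Monoid (FreeProfiniteMonoid A) :=
  inferInstanceAs (Monoid ↥(compatibleFamilies A))

/-- The inverse limit topology, each finite quotient of the free monoid being discrete. -/
instance : TopologicalSpace (FreeProfiniteMonoid A) :=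
  TopologicalSpace.induced (fun x : FreeProfiniteMonoid A => x.1)
    (@Pi.topologicalSpace (FiniteCon A) (fun c => c.1.Quotient) (fun _ => ⊥))

/-- The canonical homomorphism from the free monoid into the free profinite monoid. -/
noncomputable def ofWord : FreeMonoid A →* FreeProfiniteMonoid A where
  toFun w := ⟨fun _ => (w : Con.Quotient _), fun _ _ _ => rfl⟩
  map_one' := rfl
  map_mul' _ _ := rfl

/-- The closure in the free profinite monoid of a set of words. -/
def profiniteClosure (F : Set (FreeMonoid A)) : Set (FreeProfiniteMonoid A) :=
  closure (ofWord '' F)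

/-- The homomorphism `η̂_L` from the free profinite monoid to the syntactic monoid of a rational
language `L`, which is the projection of the inverse limit onto this finite quotient. -/
noncomputable def etaHat (L : Set (FreeMonoid A)) (hL : Finite (SyntacticMonoid L)) :
    FreeProfiniteMonoid A →* SyntacticMonoid L where
  toFun x := x.1 ⟨syntacticCon L, hL⟩
  map_one' := rfl
  map_mul' _ _ := rfl

/-- `η̂_L` extends `η_L`. -/
theorem etaHat_ofWord (L : Set (FreeMonoid A)) (hL : Finite (SyntacticMonoid L))
    (w : FreeMonoid A) : etaHat L hL (ofWord w) = eta L w := rfl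

/-- `η̂_L` is continuous for the discrete topology of the syntactic monoid. -/
theorem isOpen_preimage_etaHat (L : Set (FreeMonoid A)) (hL : Finite (SyntacticMonoid L))
    (S : Set (SyntacticMonoid L)) : IsOpen (etaHat L hL ⁻¹' S) := by
  have hc := @continuous_apply (FiniteCon A) (fun c => c.1.Quotient) (fun _ => ⊥)
    (⟨syntacticCon L, hL⟩ : FiniteCon A)
  have hS := @isOpen_discrete (SyntacticMonoid L) ⊥ (@DiscreteTopology.mk _ ⊥ rfl) S
  exact ⟨_, @Continuous.isOpen_preimage _ _ (_) (_) _ hc S hS, rfl⟩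

/-! ### The `𝓙`-classes `J(F)` and `J_F(X)`, weakly `F`-charged codes -/

/-- The `𝓙`-class `J(F)` of the free profinite monoid: the minimum `𝓙`-class meeting the closure of
the recurrent set `F`. It consists of the elements of the closure of `F` that have all elements of
the closure of `F` as factors. -/
def JClass (F : Set (FreeMonoid A)) : Set (FreeProfiniteMonoid A) :=
  {w | w ∈ profiniteClosure F ∧ ∀ v ∈ profiniteClosure F, IsFactor v w}

/-- The `𝓙`-class `J_F(X)` of the syntactic monoid of `X^*` that contains `η̂(J(F))`, where `η̂` is
the extension to pseudowords of the syntactic homomorphism of `X^*`. -/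
def JClassOf (F : Set (FreeMonoid A)) {X : Set (FreeMonoid A)} (hX : IsRationalCode X) :
    Set (SyntacticMonoid (kleeneStar X)) :=
  {s | ∃ w ∈ JClass F, GreenJ s (etaHat (kleeneStar X) hX.finite_syntacticMonoid_star w)}

/-- The rational code `X` contained in `F` is weakly `F`-charged: `η̂` maps all maximal subgroups of
`J(F)` onto maximal subgroups of `J_F(X)`. -/
def IsWeaklyCharged (F : Set (FreeMonoid A)) {X : Set (FreeMonoid A)} (hX : IsRationalCode X) :
    Prop :=
  X ⊆ F ∧ ∀ H : Set (FreeProfiniteMonoid A), IsMaximalSubgroup H → H ⊆ JClass F →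
    IsMaximalSubgroup (etaHat (kleeneStar X) hX.finite_syntacticMonoid_star '' H) ∧
      etaHat (kleeneStar X) hX.finite_syntacticMonoid_star '' H ⊆ JClassOf F hX

end WordCode

open WordCode

/-! With `e` the identity of `K`, the group `K` is the unit group of `eMe`, written `localUnits e`,
and `e` fixes every state of `Q · K`. Hence `s` and `e * s` act alike there.

Return words act through `K`: if `v` is a return word then `uv = xu` lies in `F`, so `η(uv)` is a
factor of `e` and hence of `η(u)`. Stability of the finite monoid (`exists_eq_mul_of_isFactor`)
makes `η(u)` a left multiple of `η(xu) = η(uv)`. Transported along the `𝓛`-class to `e`, this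
left-inverts `e * η(v)` in `eMe`, and finiteness makes it a unit (`mul_eta_mem_localUnits`).

Conversely, `u` is a suffix of an idempotent `f = z * u` of `J(F)`. Since `X` is weakly charged, the
unit group at `f` maps onto the one at `η̂(f)`, which is `𝓛`-equivalent to `e`. So every `g ∈ K` is
`e * η̂(h)` for a unit `h` at `f` (`IsWeaklyCharged.exists_preimage`). The pseudoword `u h z u` lies
in the closure of `F` and can be approximated by a word `u k u` of `F` with `η(ku) = η̂(h z u) =
η̂(h)` (`exists_mul_mul_mem_of_mem_profiniteClosure`). Cutting `uku` at the occurrences of `u`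
writes `ku` as a product of first return words (`mem_closure_firstReturns`), which expresses the
permutation of `g` by the `π_v`. -/

namespace WordCode

/-! ### Factors, Green's relations and subgroups -/

section Monoids

variable {M : Type*} [Monoid M]

theorem IsFactor.trans {u v w : M} (h : IsFactor u v) (k : IsFactor v w) : IsFactor u w := by
  obtain ⟨x, y, rfl⟩ := h
  obtain ⟨x', y', rfl⟩ := k
  exact ⟨x' * x, y * y', by simp only [mul_assoc]⟩

theorem IsFactor.map {N : Type*} [Monoid N] (f : M →* N) {u v : M} (h : IsFactor u v) :
    IsFactor (f u) (f v) := by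
  obtain ⟨x, y, rfl⟩ := h
  exact ⟨f x, f y, by simp only [map_mul]⟩

theorem isFactor_mul_left (u v : M) : IsFactor u (v * u) := ⟨v, 1, by simp⟩

theorem isFactor_mul_right (u v : M) : IsFactor u (u * v) := ⟨1, v, by simp⟩

theorem GreenJ.isFactor {u v : M} (h : GreenJ u v) : IsFactor v u := by
  have : u ∈ {w : M | ∃ x y, w = x * v * y} := h ▸ (⟨1, 1, by simp⟩ : ∃ x y, u = x * u * y)
  exact this

theorem GreenL.symm {u v : M} (h : GreenL u v) : GreenL v u := Eq.symm h

theorem GreenL.exists_mul {u v : M} (h : GreenL u v) : ∃ x, u = x * v := by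
  have : u ∈ {w : M | ∃ x, w = x * v} := h ▸ (⟨1, by simp⟩ : ∃ x, u = x * u)
  exact this

/-- The group of units of the local monoid `eMe`. -/
def localUnits (e : M) : Set M :=
  {x | e * x = x ∧ x * e = x ∧ ∃ y, e * y = y ∧ y * e = y ∧ x * y = e ∧ y * x = e}

theorem isSubgroupOf_localUnits {e : M} (he : e * e = e) : IsSubgroupOf (localUnits e) := by
  refine ⟨?_, e, ⟨he, he, e, he, he, he, he⟩, fun x hx => ⟨hx.1, hx.2.1⟩, ?_⟩
  · rintro x ⟨hx, hx', a, ha, ha', hxa, hax⟩ y ⟨hy, hy', b, hb, hb', hyb, hby⟩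
    refine ⟨by rw [← mul_assoc, hx], by rw [mul_assoc, hy'], b * a, by rw [← mul_assoc, hb],
      by rw [mul_assoc, ha'], ?_, ?_⟩
    · rw [mul_assoc, ← mul_assoc y, hyb, ha, hxa]
    · rw [mul_assoc, ← mul_assoc a, hax, hy, hby]
  · rintro x ⟨hx, hx', a, ha, ha', hxa, hax⟩
    exact ⟨a, ⟨ha, ha', x, hx, hx', hax, hxa⟩, hxa, hax⟩

/-- A group has only one idempotent, so any subgroup containing `e` has identity `e` and consists of
units of `eMe`. -/
theorem isMaximalSubgroup_localUnits {e : M} (he : e * e = e) :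
    IsMaximalSubgroup (localUnits e) := by
  refine ⟨isSubgroupOf_localUnits he, ?_⟩
  rintro K ⟨-, e', he', hid, hinv⟩ hle
  have heK : e ∈ K := hle ⟨he, he, e, he, he, he, he⟩
  obtain ⟨y, hy, hy1, hy2⟩ := hinv e heK
  have hee : e = e' := by
    calc e = e' * e := (hid e heK).1.symm
      _ = y * e * e := by rw [hy2]
      _ = e' := by rw [mul_assoc, he, hy2]
  subst hee
  intro x hx
  obtain ⟨z, hz, hz1, hz2⟩ := hinv x hx
  exact ⟨(hid x hx).1, (hid x hx).2, z, (hid z hz).1, (hid z hz).2, hz1, hz2⟩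

theorem IsMaximalSubgroup.eq_localUnits {K : Set M} (hK : IsMaximalSubgroup K) {e : M}
    (heK : e ∈ K) (he : e * e = e) : K = localUnits e := by
  obtain ⟨-, e', he', hid, hinv⟩ := hK.1
  obtain ⟨y, hy, hy1, hy2⟩ := hinv e heK
  have hee : e = e' := by
    calc e = e' * e := (hid e heK).1.symm
      _ = y * e * e := by rw [hy2]
      _ = e' := by rw [mul_assoc, he, hy2]
  subst hee
  have hle : K ⊆ localUnits e := by
    intro x hx
    obtain ⟨z, hz, hz1, hz2⟩ := hinv x hx
    exact ⟨(hid x hx).1, (hid x hx).2, z, (hid z hz).1, (hid z hz).2, hz1, hz2⟩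
  exact hle.antisymm (hK.2 (isSubgroupOf_localUnits he) hle)

/-- In a finite monoid, an element of `eMe` that is left invertible in `eMe` is a unit. -/
theorem mem_localUnits_of_left_inverse [Finite M] {e m n : M}
    (hem : e * m = m) (hme : m * e = m) (hen : e * n = n) (hne : n * e = n) (h : n * m = e) :
    m ∈ localUnits e := by
  refine ⟨hem, hme, n, hen, hne, ?_, h⟩
  have he : e * e = e := by
    calc e * e = e * (n * m) := by rw [h]
      _ = e := by rw [← mul_assoc, hen, h]
  -- Left multiplication by `n` on `eM` is surjective because `n * m = e`, hence injective by
  -- finiteness. It sends both `m * n` and `e` to `n`.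
  let f : {x : M // e * x = x} → {x : M // e * x = x} := fun x =>
    ⟨n * x.1, by rw [← mul_assoc, hen]⟩
  have hf : Function.Surjective f := fun x =>
    ⟨⟨m * x.1, by rw [← mul_assoc, hem]⟩, Subtype.ext (by
      change n * (m * x.1) = x.1
      rw [← mul_assoc, h, x.2])⟩
  have hinj := Finite.injective_iff_surjective.2 hf
  have := @hinj ⟨m * n, by rw [← mul_assoc, hem]⟩ ⟨e, he⟩ (Subtype.ext (by
    change n * (m * n) = n * e
    rw [← mul_assoc, h, hen, hne]))
  exact congrArg Subtype.val this

/-- If `s = a * s * b` in a compact monoid, then `s` is fixed by an idempotent that is both a left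
and a right multiple of `a`. -/
theorem exists_idempotent_mul_eq [TopologicalSpace M] [CompactSpace M] [T2Space M] [ContinuousMul M]
    {s a b : M} (h : s = a * s * b) :
    ∃ e : M, e * e = e ∧ e * s = s ∧ (∃ r, e = a * r) ∧ ∃ r, e = r * a := by
  -- The left parts of pairs fixing `s`, cut down to `aM ∩ Ma`, form a compact subsemigroup
  -- containing `a`. An idempotent `e'` in it satisfies `e' s q = s` for some `q`, whence `e' s =
  -- s`.
  let T : Set M := (Prod.fst '' {p : M × M | p.1 * s * p.2 = s}) ∩
    (Set.range (fun r => a * r) ∩ Set.range (fun r => r * a))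
  have hT : IsCompact T := by
    have h1 : IsClosed {p : M × M | p.1 * s * p.2 = s} :=
      isClosed_eq (by fun_prop) continuous_const
    exact (h1.isCompact.image continuous_fst).inter
      ((isCompact_range (by fun_prop)).inter (isCompact_range (by fun_prop)))
  have hne : T.Nonempty := ⟨a, ⟨(a, b), h.symm, rfl⟩, ⟨1, mul_one a⟩, ⟨1, one_mul a⟩⟩
  obtain ⟨e, ⟨⟨⟨e', q⟩, hq, rfl⟩, ⟨r, hr⟩, ⟨r', hr'⟩⟩, hee⟩ :=
    exists_idempotent_in_compact_subsemigroup (fun r => continuous_mul_const r) T hne hT (by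
      rintro _ ⟨⟨⟨x, y⟩, hxy, rfl⟩, ⟨r, hr⟩, -⟩ _ ⟨⟨⟨x', y'⟩, hxy', rfl⟩, -, ⟨r', hr'⟩⟩
      simp only [Set.mem_ofPred_eq] at *
      refine ⟨⟨(x * x', y' * y), ?_, rfl⟩, ⟨r * x', ?_⟩, ⟨x * r', ?_⟩⟩
      · calc x * x' * s * (y' * y) = x * (x' * s * y') * y := by simp only [mul_assoc]
          _ = s := by rw [hxy', hxy]
      · change a * (r * x') = x * x'
        rw [← mul_assoc, hr]
      · change x * r' * a = x * x'
        rw [mul_assoc, hr'])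
  refine ⟨e', hee, ?_, ⟨r, hr.symm⟩, ⟨r', hr'.symm⟩⟩
  have hq' : e' * s * q = s := hq
  have hee' : e' * e' = e' := hee
  calc e' * s = e' * (e' * s * q) := by rw [hq']
    _ = s := by rw [← mul_assoc, ← mul_assoc, hee', hq']

/-- Stability of finite monoids. -/
theorem exists_eq_mul_of_isFactor [Finite M] {s x : M} (h : IsFactor (x * s) s) :
    ∃ y, s = y * (x * s) := by
  obtain ⟨p, q, hs⟩ := h
  let : TopologicalSpace M := ⊥
  have : DiscreteTopology M := ⟨rfl⟩
  obtain ⟨e, -, hes, -, r, hr⟩ := exists_idempotent_mul_eq (s := s) (a := p * x) (b := q)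
    (by simpa only [mul_assoc] using hs)
  refine ⟨r * p, ?_⟩
  calc s = r * (p * x) * s := by rw [← hr, hes]
    _ = r * p * (x * s) := by simp only [mul_assoc]

end Monoids

variable {A : Type*}

/-! ### The free profinite monoid -/

/-- Each compatibility condition is closed in the product of finite discrete quotients. Compactness,
separation and continuity of the product are inherited through this embedding. -/
theorem isClosedEmbedding_val_freeProfiniteMonoid :
    @Topology.IsClosedEmbedding (FreeProfiniteMonoid A) (∀ c : FiniteCon A, c.1.Quotient) _
      (@Pi.topologicalSpace (FiniteCon A) (fun c => c.1.Quotient) (fun _ => ⊥)) Subtype.val := by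
  let : ∀ c : FiniteCon A, TopologicalSpace c.1.Quotient := fun _ => ⊥
  have : ∀ c : FiniteCon A, DiscreteTopology c.1.Quotient := fun _ => ⟨rfl⟩
  refine ⟨⟨⟨rfl⟩, Subtype.val_injective⟩, ?_⟩
  have : Set.range (Subtype.val : FreeProfiniteMonoid A → ∀ c : FiniteCon A, c.1.Quotient) =
      ⋂ (c : FiniteCon A) (d : FiniteCon A) (h : c.1 ≤ d.1),
        {x | Con.map c.1 d.1 h (x c) = x d} := by
    ext x
    simp only [Set.mem_iInter]
    exact ⟨fun ⟨y, hy⟩ => hy ▸ y.2, fun h => ⟨⟨x, h⟩, rfl⟩⟩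
  refine (congrArg IsClosed this).mpr ?_
  refine isClosed_iInter fun c => isClosed_iInter fun d => isClosed_iInter fun h => isClosed_eq ?_ ?_
  · exact continuous_of_discreteTopology.comp (continuous_apply c)
  · exact continuous_apply d

instance : CompactSpace (FreeProfiniteMonoid A) := by
  let : ∀ c : FiniteCon A, TopologicalSpace c.1.Quotient := fun _ => ⊥
  have : ∀ c : FiniteCon A, Finite c.1.Quotient := fun c => c.2
  exact isClosedEmbedding_val_freeProfiniteMonoid.compactSpace

instance : T2Space (FreeProfiniteMonoid A) := by
  let : ∀ c : FiniteCon A, TopologicalSpace c.1.Quotient := fun _ => ⊥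
  have : ∀ c : FiniteCon A, DiscreteTopology c.1.Quotient := fun _ => ⟨rfl⟩
  exact isClosedEmbedding_val_freeProfiniteMonoid.isEmbedding.t2Space

instance : ContinuousMul (FreeProfiniteMonoid A) := by
  let : ∀ c : FiniteCon A, TopologicalSpace c.1.Quotient := fun _ => ⊥
  have : ∀ c : FiniteCon A, DiscreteTopology c.1.Quotient := fun _ => ⟨rfl⟩
  exact Topology.IsInducing.continuousMul (compatibleFamilies A).subtype
    isClosedEmbedding_val_freeProfiniteMonoid.isInducing

variable (A) in
/-- The projection of the free profinite monoid onto a finite quotient of the free monoid. -/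
def proj (c : FiniteCon A) : FreeProfiniteMonoid A →* c.1.Quotient where
  toFun x := x.1 c
  map_one' := rfl
  map_mul' _ _ := rfl

theorem map_proj {c d : FiniteCon A} (h : c.1 ≤ d.1) (x : FreeProfiniteMonoid A) :
    Con.map c.1 d.1 h (proj A c x) = proj A d x := x.2 c d h

theorem proj_eq_of_le {c d : FiniteCon A} (h : c.1 ≤ d.1) {x y : FreeProfiniteMonoid A}
    (hxy : proj A c x = proj A c y) : proj A d x = proj A d y := by
  rw [← map_proj h, ← map_proj h, hxy]

theorem exists_proj_ofWord_eq (c : FiniteCon A) (x : FreeProfiniteMonoid A) :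
    ∃ w, proj A c (ofWord w) = proj A c x := c.1.mk'_surjective (proj A c x)

theorem isOpen_preimage_proj (c : FiniteCon A) (S : Set c.1.Quotient) :
    IsOpen (proj A c ⁻¹' S) := by
  let : ∀ c : FiniteCon A, TopologicalSpace c.1.Quotient := fun _ => ⊥
  have : ∀ c : FiniteCon A, DiscreteTopology c.1.Quotient := fun _ => ⟨rfl⟩
  exact (isOpen_discrete S).preimage
    ((continuous_apply c).comp isClosedEmbedding_val_freeProfiniteMonoid.continuous)

theorem finite_quotient_inf {c d : Con (FreeMonoid A)} (hc : Finite c.Quotient)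
    (hd : Finite d.Quotient) : Finite (c ⊓ d).Quotient := by
  let f := (Con.map (c ⊓ d) c inf_le_left).prod (Con.map (c ⊓ d) d inf_le_right)
  refine Finite.of_injective f fun s t h => ?_
  obtain ⟨x, rfl⟩ := (c ⊓ d).mk'_surjective s
  obtain ⟨y, rfl⟩ := (c ⊓ d).mk'_surjective t
  exact (c ⊓ d).eq.2 ⟨c.eq.1 (congrArg Prod.fst h), d.eq.1 (congrArg Prod.snd h)⟩

/-- The intersection of two congruences of finite index. -/
def FiniteCon.inf (c d : FiniteCon A) : FiniteCon A := ⟨c.1 ⊓ d.1, finite_quotient_inf c.2 d.2⟩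

theorem exists_finiteCon_le (I : Finset (FiniteCon A)) :
    ∃ c : FiniteCon A, ∀ d ∈ I, c.1 ≤ d.1 := by
  classical
  induction I using Finset.induction_on with
  | empty =>
    refine ⟨⟨⊤, ?_⟩, by simp⟩
    refine Finite.of_injective (fun _ => ()) fun s t _ => ?_
    obtain ⟨x, rfl⟩ := (⊤ : Con (FreeMonoid A)).mk'_surjective s
    obtain ⟨y, rfl⟩ := (⊤ : Con (FreeMonoid A)).mk'_surjective t
    exact (Con.eq _).2 trivial
  | insert d I _ ih =>
    obtain ⟨c, hc⟩ := ih
    refine ⟨d.inf c, fun d' hd' => ?_⟩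
    rcases Finset.mem_insert.1 hd' with rfl | h
    · exact inf_le_left
    · exact inf_le_right.trans (hc d' h)

/-- A basic neighbourhood constrains finitely many coordinates, and all of these are determined by
the coordinate at one common finer congruence of finite index. -/
theorem mem_profiniteClosure_iff {S : Set (FreeMonoid A)} {x : FreeProfiniteMonoid A} :
    x ∈ profiniteClosure S ↔ ∀ c : FiniteCon A, ∃ w ∈ S, proj A c (ofWord w) = proj A c x := by
  constructor
  · intro h c
    obtain ⟨_, hy, w, hw, rfl⟩ := mem_closure_iff.1 h _ (isOpen_preimage_proj c {proj A c x}) rfl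
    exact ⟨w, hw, hy⟩
  · intro h
    let : ∀ c : FiniteCon A, TopologicalSpace c.1.Quotient := fun _ => ⊥
    have : ∀ c : FiniteCon A, DiscreteTopology c.1.Quotient := fun _ => ⟨rfl⟩
    refine mem_closure_iff.2 fun O hO hx => ?_
    obtain ⟨U, hU, rfl⟩ := isClosedEmbedding_val_freeProfiniteMonoid.isInducing.isOpen_iff.1 hO
    obtain ⟨I, V, hV, hIV⟩ := isOpen_pi_iff.1 hU _ hx
    obtain ⟨c, hc⟩ := exists_finiteCon_le I
    obtain ⟨w, hw, hwx⟩ := h c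
    refine ⟨ofWord w, hIV fun d hd => ?_, w, hw, rfl⟩
    have : proj A d (ofWord w) = proj A d x := proj_eq_of_le (hc d hd) hwx
    have h2 := (hV d hd).2
    change proj A d x ∈ V d at h2
    change proj A d (ofWord w) ∈ V d
    rwa [this]

theorem ofWord_mem_profiniteClosure {S : Set (FreeMonoid A)} {w : FreeMonoid A} (hw : w ∈ S) :
    ofWord w ∈ profiniteClosure S := subset_closure ⟨w, hw, rfl⟩

theorem freeMonoid_mul_eq_mul {a b c d : FreeMonoid A} (h : a * b = c * d) :
    (∃ t, c = a * t ∧ b = t * d) ∨ ∃ t, a = c * t ∧ d = t * b :=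
  List.append_eq_append_iff.1 h

/-- Two words are congruent if they have the same factorizations into two factors modulo `c`. -/
def factorizationCon (c : Con (FreeMonoid A)) : Con (FreeMonoid A) where
  r u v := {p : c.Quotient × c.Quotient | ∃ x y : FreeMonoid A, u = x * y ∧ p = (↑x, ↑y)} =
    {p : c.Quotient × c.Quotient | ∃ x y : FreeMonoid A, v = x * y ∧ p = (↑x, ↑y)}
  iseqv := ⟨fun _ => rfl, fun h => h.symm, fun h k => h.trans k⟩
  mul' := by
    -- The factorization `u * 1` already recovers the class of `u` modulo `c`.
    have hle : ∀ {u u' : FreeMonoid A},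
        {p : c.Quotient × c.Quotient | ∃ x y : FreeMonoid A, u = x * y ∧ p = (↑x, ↑y)} ⊆
        {p : c.Quotient × c.Quotient | ∃ x y : FreeMonoid A, u' = x * y ∧ p = (↑x, ↑y)} →
        (u : c.Quotient) = u' := by
      intro u u' h
      obtain ⟨x, y, rfl, hp⟩ := h ⟨u, 1, (mul_one u).symm, rfl⟩
      obtain ⟨h1, h2⟩ := Prod.ext_iff.1 hp
      simp only at h1 h2
      rw [Con.coe_mul, ← h1, ← h2, Con.coe_one, mul_one]
    -- A cut of `u * v` falls inside `u` or inside `v`; it is imitated on that side, the other side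
    -- being replaced by a word congruent modulo `c`.
    have key : ∀ {u u' v v' : FreeMonoid A},
        {p : c.Quotient × c.Quotient | ∃ x y : FreeMonoid A, u = x * y ∧ p = (↑x, ↑y)} ⊆
        {p : c.Quotient × c.Quotient | ∃ x y : FreeMonoid A, u' = x * y ∧ p = (↑x, ↑y)} →
        {p : c.Quotient × c.Quotient | ∃ x y : FreeMonoid A, v = x * y ∧ p = (↑x, ↑y)} ⊆
        {p : c.Quotient × c.Quotient | ∃ x y : FreeMonoid A, v' = x * y ∧ p = (↑x, ↑y)} →
        {p : c.Quotient × c.Quotient | ∃ x y : FreeMonoid A, u * v = x * y ∧ p = (↑x, ↑y)} ⊆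
        {p : c.Quotient × c.Quotient | ∃ x y : FreeMonoid A, u' * v' = x * y ∧ p = (↑x, ↑y)} := by
      rintro u u' v v' h k _ ⟨x, y, hxy, rfl⟩
      rcases freeMonoid_mul_eq_mul hxy with ⟨t, rfl, rfl⟩ | ⟨t, rfl, rfl⟩
      · obtain ⟨t', y', rfl, hp⟩ := k ⟨t, y, rfl, rfl⟩
        obtain ⟨h1, h2⟩ := Prod.ext_iff.1 hp
        simp only at h1 h2
        exact ⟨u' * t', y', by rw [mul_assoc], by rw [Con.coe_mul, Con.coe_mul, hle h, h1, h2]⟩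
      · obtain ⟨x', t', rfl, hp⟩ := h ⟨x, t, rfl, rfl⟩
        obtain ⟨h1, h2⟩ := Prod.ext_iff.1 hp
        simp only at h1 h2
        exact ⟨x', t' * v', by rw [mul_assoc], by rw [Con.coe_mul, Con.coe_mul, hle k, h1, h2]⟩
    intro u u' v v' h k
    exact (key h.subset k.subset).antisymm (key h.superset k.superset)

theorem finite_factorizationCon {c : Con (FreeMonoid A)} (hc : Finite c.Quotient) :
    Finite (factorizationCon c).Quotient := by
  refine Finite.of_injective (β := Set (c.Quotient × c.Quotient))
    (fun s => Con.liftOn s (fun u => {p | ∃ x y : FreeMonoid A, u = x * y ∧ p = (↑x, ↑y)})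
      fun _ _ h => h) fun s t h => ?_
  obtain ⟨x, rfl⟩ := (factorizationCon c).mk'_surjective s
  obtain ⟨y, rfl⟩ := (factorizationCon c).mk'_surjective t
  exact (factorizationCon c).eq.2 h

/-- The congruence `factorizationCon` as a congruence of finite index. -/
def FiniteCon.factorization (c : FiniteCon A) : FiniteCon A :=
  ⟨factorizationCon c.1, finite_factorizationCon c.2⟩

/-- A word that is close to a product of pseudowords is a product of words close to the factors. -/
theorem exists_factorization {c : FiniteCon A} {w : FreeMonoid A} {x y : FreeProfiniteMonoid A}
    (h : proj A c.factorization (ofWord w) = proj A c.factorization (x * y)) :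
    ∃ x' y' : FreeMonoid A, w = x' * y' ∧ proj A c (ofWord x') = proj A c x ∧
      proj A c (ofWord y') = proj A c y := by
  -- The word `x₀` must agree with `x` modulo `c.factorization`, to compare products, and modulo
  -- `c`, to read off the conclusion.
  obtain ⟨x₀, hx₀⟩ := exists_proj_ofWord_eq (c.factorization.inf c) x
  obtain ⟨y₀, hy₀⟩ := exists_proj_ofWord_eq (c.factorization.inf c) y
  have h1 : proj A c.factorization (ofWord w) = proj A c.factorization (ofWord (x₀ * y₀)) := by
    rw [h, map_mul, map_mul, map_mul, proj_eq_of_le inf_le_left hx₀, proj_eq_of_le inf_le_left hy₀]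
  have h2 : factorizationCon c.1 w (x₀ * y₀) := (Con.eq _).1 h1
  have h3 : ((x₀, y₀) : c.1.Quotient × c.1.Quotient) ∈
      {p : c.1.Quotient × c.1.Quotient | ∃ x y : FreeMonoid A, w = x * y ∧ p = (↑x, ↑y)} := by
    have : {p : c.1.Quotient × c.1.Quotient | ∃ x y : FreeMonoid A, w = x * y ∧ p = (↑x, ↑y)} =
      {p : c.1.Quotient × c.1.Quotient | ∃ x y : FreeMonoid A, x₀ * y₀ = x * y ∧ p = (↑x, ↑y)} := h2
    rw [this]
    exact ⟨x₀, y₀, rfl, rfl⟩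
  obtain ⟨x', y', hw, hp⟩ := h3
  obtain ⟨hp1, hp2⟩ := Prod.ext_iff.1 hp
  refine ⟨x', y', hw, ?_, ?_⟩
  · rw [← proj_eq_of_le (inf_le_right : (c.factorization.inf c).1 ≤ c.1) hx₀]
    exact hp1.symm
  · rw [← proj_eq_of_le (inf_le_right : (c.factorization.inf c).1 ≤ c.1) hy₀]
    exact hp2.symm

/-- Two words are congruent if they are equal or both of length greater than `n`. -/
def lengthCon (A : Type*) (n : ℕ) : Con (FreeMonoid A) where
  r u v := u = v ∨ (n < u.length ∧ n < v.length)
  iseqv := ⟨fun _ => Or.inl rfl, fun h => h.elim (fun h => Or.inl h.symm) fun h => Or.inr h.symm,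
    by grind⟩
  mul' := by
    intro u u' v v' h k
    simp only [FreeMonoid.length_mul]
    grind

theorem finite_lengthCon [Finite A] (n : ℕ) : Finite (lengthCon A n).Quotient := by
  have hfin : Finite {l : FreeMonoid A // l.length ≤ n} := (List.finite_length_le A n).to_subtype
  let f : Option {l : FreeMonoid A // l.length ≤ n} → Set (lengthCon A n).Quotient := fun o =>
    o.elim {s | ∃ w : FreeMonoid A, n < w.length ∧ s = w} fun l => {(l.1 : (lengthCon A n).Quotient)}
  have : (⋃ o, f o) = Set.univ := by
    refine Set.eq_univ_of_forall fun s => ?_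
    obtain ⟨w, rfl⟩ := (lengthCon A n).mk'_surjective s
    by_cases hw : w.length ≤ n
    · exact Set.mem_iUnion.2 ⟨some ⟨w, hw⟩, rfl⟩
    · exact Set.mem_iUnion.2 ⟨none, w, not_le.1 hw, rfl⟩
  refine Set.finite_univ_iff.1 (this ▸ Set.finite_iUnion fun o => ?_)
  cases o with
  | some l => exact Set.finite_singleton _
  | none =>
    refine Set.Subsingleton.finite ?_
    rintro _ ⟨w, hw, rfl⟩ _ ⟨w', hw', rfl⟩
    exact (Con.eq _).2 (Or.inr ⟨hw, hw'⟩)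

/-- The congruence `lengthCon` as a congruence of finite index. -/
def FiniteCon.length (A : Type*) [Finite A] (n : ℕ) : FiniteCon A :=
  ⟨lengthCon A n, finite_lengthCon n⟩

/-- Only words strictly longer than `u` are collapsed, so `u` is alone in its class: words of `A^*`
are isolated points. -/
theorem eq_of_proj_length_eq [Finite A] {w u : FreeMonoid A}
    (h : proj A (FiniteCon.length A u.length) (ofWord w) =
      proj A (FiniteCon.length A u.length) (ofWord u)) : w = u := by
  have : lengthCon A u.length w u := (Con.eq _).1 h
  exact this.resolve_right fun h => lt_irrefl _ h.2

/-! ### The closure of a recurrent set and its minimum `𝓙`-class -/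

/-- A word of `F` close to `x * u * y` has a factor close to `u`; the factorization congruence is
iterated because two cuts are needed. -/
theorem IsFactorial.mem_profiniteClosure {F : Set (FreeMonoid A)} (hF : IsFactorial F)
    {u v : FreeProfiniteMonoid A} (h : IsFactor u v) (hv : v ∈ profiniteClosure F) :
    u ∈ profiniteClosure F := by
  obtain ⟨x, y, rfl⟩ := h
  refine mem_profiniteClosure_iff.2 fun c => ?_
  obtain ⟨w, hw, hwv⟩ := mem_profiniteClosure_iff.1 hv c.factorization.factorization
  obtain ⟨a, b, rfl, ha, -⟩ := exists_factorization hwv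
  obtain ⟨a', u', rfl, -, hu⟩ := exists_factorization ha
  exact ⟨u', hF _ _ ⟨a', b, rfl⟩ hw, hu⟩

/-- By compactness, the elements `w` admitting such an `x` form a closed set, and recurrence puts
the words of `F` in it. -/
theorem IsRecurrent.exists_mul_mul_mem {F : Set (FreeMonoid A)} (hF : IsRecurrent F)
    {w : FreeProfiniteMonoid A} (hw : w ∈ profiniteClosure F) :
    ∃ x, w * x * w ∈ profiniteClosure F := by
  have hC : IsClosed {p : FreeProfiniteMonoid A × FreeProfiniteMonoid A |
      p.1 * p.2 * p.1 ∈ profiniteClosure F} := isClosed_closure.preimage (by fun_prop)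
  have hC' := (hC.isCompact.image continuous_fst).isClosed
  have hsub : ofWord '' F ⊆ Prod.fst '' {p : FreeProfiniteMonoid A × FreeProfiniteMonoid A |
      p.1 * p.2 * p.1 ∈ profiniteClosure F} := by
    rintro _ ⟨u, hu, rfl⟩
    obtain ⟨x, -, hx⟩ := hF.recurrent u hu u hu
    refine ⟨(ofWord u, ofWord x), ?_, rfl⟩
    change ofWord u * ofWord x * ofWord u ∈ profiniteClosure F
    rw [← map_mul, ← map_mul]
    exact ofWord_mem_profiniteClosure hx
  obtain ⟨⟨_, x⟩, hx, rfl⟩ := closure_minimal hsub hC' hw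
  exact ⟨x, hx⟩

theorem mem_JClass_of_isFactor {F : Set (FreeMonoid A)} (hF : IsFactorial F)
    {w w' : FreeProfiniteMonoid A} (hw : w ∈ JClass F) (h : IsFactor w w') (h' : IsFactor w' w) :
    w' ∈ JClass F :=
  ⟨hF.mem_profiniteClosure h' hw.1, fun v hv => (hw.2 v hv).trans h⟩

/-- The `𝓙`-class `J(F)` is regular. -/
theorem IsRecurrent.exists_idempotent_mem_JClass {F : Set (FreeMonoid A)} (hF : IsRecurrent F)
    (h : (JClass F).Nonempty) : ∃ f ∈ JClass F, f * f = f := by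
  obtain ⟨w, hw⟩ := h
  obtain ⟨x, hx⟩ := hF.exists_mul_mul_mem hw.1
  obtain ⟨a, b, hab⟩ := hw.2 _ hx
  -- The choice `a * w * x` makes `w` a factor of `e`, while `e * w = w` makes `e` a factor of `w`.
  obtain ⟨e, hee, hew, ⟨r, hr⟩, -⟩ := exists_idempotent_mul_eq (s := w) (a := a * w * x) (b := b)
    (by simpa only [mul_assoc] using hab)
  refine ⟨e, mem_JClass_of_isFactor hF.factorial hw ⟨a, x * r, ?_⟩ ?_, hee⟩
  · rw [hr]
    simp only [mul_assoc]
  · have := isFactor_mul_right e w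
    rwa [hew] at this

/-- Every word of `F` is a suffix of an idempotent of `J(F)`. -/
theorem IsRecurrent.exists_idempotent_mul_ofWord {F : Set (FreeMonoid A)} (hF : IsRecurrent F)
    (h : (JClass F).Nonempty) {u : FreeMonoid A} (hu : u ∈ F) :
    ∃ z : FreeProfiniteMonoid A, z * ofWord u ∈ JClass F ∧
      z * ofWord u * (z * ofWord u) = z * ofWord u := by
  obtain ⟨f, hf, hff⟩ := hF.exists_idempotent_mem_JClass h
  obtain ⟨x, y, hxy⟩ := hf.2 _ (ofWord_mem_profiniteClosure hu)
  -- As `f = x u y`, the cyclic shift `y f x u` is idempotent because `f (x u y) f = f`, and `f = (x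
  -- u) (y f x u) y` returns to `f`.
  refine ⟨y * f * x, mem_JClass_of_isFactor hF.factorial hf ⟨y, x * ofWord u, ?_⟩
    ⟨x * ofWord u, y, ?_⟩, ?_⟩
  · simp only [mul_assoc]
  · calc f = f * f * f := by rw [hff, hff]
      _ = x * ofWord u * y * f * (x * ofWord u * y) := by rw [← hxy]
      _ = _ := by simp only [mul_assoc]
  · calc y * f * x * ofWord u * (y * f * x * ofWord u)
        = y * (f * (x * ofWord u * y) * f) * (x * ofWord u) := by simp only [mul_assoc]
      _ = y * f * (x * ofWord u) := by rw [← hxy, hff, hff]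
      _ = _ := by simp only [mul_assoc]

/-- The group of units at an idempotent of `J(F)` is contained in `J(F)`. -/
theorem localUnits_subset_JClass {F : Set (FreeMonoid A)} (hF : IsFactorial F)
    {f : FreeProfiniteMonoid A} (hf : f ∈ JClass F) : localUnits f ⊆ JClass F := by
  rintro x ⟨hx, -, y, -, -, hxy, -⟩
  refine mem_JClass_of_isFactor hF hf ?_ ?_
  · exact hx ▸ isFactor_mul_right f x
  · exact hxy ▸ isFactor_mul_right x y

/-! ### First return words -/

/-- An internal occurrence of `u` in `u * w` splits `w` into two shorter words with the same
property; if there is none, `w` is `1` or a first return. -/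
theorem mem_closure_firstReturns {F : Set (FreeMonoid A)} (hF : IsFactorial F) {u : FreeMonoid A}
    (w : FreeMonoid A) (hw : u * w ∈ F) (hs : ∃ x, u * w = x * u) :
    w ∈ Submonoid.closure (firstReturns F u) := by
  induction hn : w.length using Nat.strong_induction_on generalizing w with
  | _ n ih =>
    by_cases h1 : w = 1
    · exact h1 ▸ Submonoid.one_mem _
    by_cases h : ∃ x y : FreeMonoid A, x ≠ 1 ∧ y ≠ 1 ∧ u * w = x * u * y
    · obtain ⟨x, y, hx, hy, hxy⟩ := h
      have hpos : ∀ {z : FreeMonoid A}, z ≠ 1 → 0 < z.length := fun hz =>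
        Nat.pos_of_ne_zero fun h => hz (FreeMonoid.length_eq_zero.1 h)
      have hlen : ∀ {a b : FreeMonoid A}, a = b → a.length = b.length := fun h => h ▸ rfl
      have hprefix : ∃ t, x * u = u * t ∧ w = t * y := by
        rcases freeMonoid_mul_eq_mul hxy with h | ⟨t, ht, -⟩
        · exact h
        · have := hlen ht
          have := hpos hx
          simp only [FreeMonoid.length_mul] at *
          omega
      have hsuffix : ∃ t, u * y = t * u := by
        obtain ⟨s, hs⟩ := hs
        rw [hxy, mul_assoc] at hs
        rcases freeMonoid_mul_eq_mul hs with ⟨t, -, ht⟩ | ⟨t, -, ht⟩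
        · exact ⟨t, ht⟩
        · have := hlen ht
          have := hpos hy
          simp only [FreeMonoid.length_mul] at *
          omega
      obtain ⟨t, ht, rfl⟩ := hprefix
      have ht0 : 0 < t.length := by
        have := hlen ht
        have := hpos hx
        simp only [FreeMonoid.length_mul] at *
        omega
      have hy0 := hpos hy
      simp only [FreeMonoid.length_mul] at hn
      refine Submonoid.mul_mem _ (ih t.length (by omega) t ?_ ⟨x, ht.symm⟩ rfl)
        (ih y.length (by omega) y ?_ hsuffix rfl)
      · exact hF _ _ ⟨1, y, by rw [one_mul, mul_assoc]⟩ hw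
      · exact hF _ _ ⟨x, 1, by rw [mul_one, hxy, mul_assoc]⟩ hw
    · exact Submonoid.subset_closure ⟨h1, hw, hs, h⟩

/-! ### The action on the minimal automaton -/

theorem leftQuot_leftQuot (L : Set (FreeMonoid A)) (w w' : FreeMonoid A) :
    leftQuot (leftQuot L w) w' = leftQuot L (w * w') := by
  ext y
  simp [leftQuot, mul_assoc]

theorem wordAct_eq_some_iff {L : Set (FreeMonoid A)} {q p : MinState L} {w : FreeMonoid A} :
    wordAct L q w = some p ↔ leftQuot q.1 w = p.1 := by
  unfold wordAct
  split_ifs with h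
  · exact Option.some_inj.trans Subtype.ext_iff
  · exact ⟨fun hp => hp.elim, fun hp => absurd (hp ▸ p.2.1) h⟩

/-- If the final quotient is nonempty then so is the intermediate one, so the path is defined
throughout. -/
theorem wordAct_mul_eq_some_iff {L : Set (FreeMonoid A)} {q r : MinState L} {w w' : FreeMonoid A} :
    wordAct L q (w * w') = some r ↔ ∃ p, wordAct L q w = some p ∧ wordAct L p w' = some r := by
  simp only [wordAct_eq_some_iff, ← leftQuot_leftQuot]
  constructor
  · intro h
    obtain ⟨y, hy⟩ : (leftQuot (leftQuot q.1 w) w').Nonempty := h ▸ r.2.1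
    obtain ⟨u, hu⟩ := q.2.2
    exact ⟨⟨leftQuot q.1 w, ⟨w' * y, hy⟩, u * w, by rw [hu, leftQuot_leftQuot]⟩, rfl, h⟩
  · rintro ⟨p, hp, h⟩
    rw [hp, h]

theorem act_mul_eq_some_iff {L : Set (FreeMonoid A)} {q r : MinState L} {s t : SyntacticMonoid L} :
    act L q (s * t) = some r ↔ ∃ p, act L q s = some p ∧ act L p t = some r := by
  obtain ⟨w, rfl⟩ := (syntacticCon L).mk'_surjective s
  obtain ⟨w', rfl⟩ := (syntacticCon L).mk'_surjective t
  exact wordAct_mul_eq_some_iff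

theorem act_one (L : Set (FreeMonoid A)) (q : MinState L) : act L q 1 = some q := by
  change wordAct L q 1 = some q
  rw [wordAct_eq_some_iff]
  ext y
  simp [leftQuot]

section ActsAs

variable {L : Set (FreeMonoid A)} {Y : Set (MinState L)}

theorem ActsAs.one : ActsAs L Y 1 1 := fun q => act_one L q.1

/-- The monoid acts on the right while permutations compose from the left, which reverses the order.
-/
theorem ActsAs.mul {s t : SyntacticMonoid L} {π ρ : Equiv.Perm Y} (hs : ActsAs L Y s π)
    (ht : ActsAs L Y t ρ) : ActsAs L Y (s * t) (ρ * π) := fun q =>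
  act_mul_eq_some_iff.2 ⟨π q, hs q, ht (π q)⟩

theorem ActsAs.unique {s : SyntacticMonoid L} {π ρ : Equiv.Perm Y} (hπ : ActsAs L Y s π)
    (hρ : ActsAs L Y s ρ) : π = ρ := by
  ext q
  exact Option.some_injective _ ((hπ q).symm.trans (hρ q))

theorem ActsAs.of_mul_left {e s : SyntacticMonoid L} {π : Equiv.Perm Y} (he : ActsAs L Y e 1)
    (h : ActsAs L Y (e * s) π) : ActsAs L Y s π := by
  intro q
  obtain ⟨p, hp, hs⟩ := act_mul_eq_some_iff.1 (h q)
  obtain rfl : q.1 = p := Option.some_injective _ ((he q).symm.trans hp)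
  exact hs

variable {e : SyntacticMonoid L}

/-- Every `g` in the group equals `g * e`, so a state reached by `g` is reached by `e`, and `e * e =
e` then fixes it. -/
theorem actsAs_idempotent (he : e * e = e) : ActsAs L (statesAct L (localUnits e)) e 1 := by
  rintro ⟨p, q, g, hg, h⟩
  rw [← hg.2.1] at h
  obtain ⟨p', hp', hp⟩ := act_mul_eq_some_iff.1 h
  have h2 : act L p' (e * e) = some p := by rw [he, hp]
  obtain ⟨p'', h3, h4⟩ := act_mul_eq_some_iff.1 h2
  obtain rfl : p = p'' := Option.some_injective _ (hp.symm.trans h3)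
  exact h4

theorem exists_act_eq_some (he : e * e = e) {g : SyntacticMonoid L} (hg : g ∈ localUnits e)
    (q : statesAct L (localUnits e)) : ∃ p : statesAct L (localUnits e), act L q.1 g = some p.1 := by
  obtain ⟨-, -, y, -, -, hgy, -⟩ := id hg
  have h1 : act L q.1 (g * y) = some q.1 :=
    (congrArg (act L q.1) hgy).trans (actsAs_idempotent he q)
  obtain ⟨p, hp, -⟩ := act_mul_eq_some_iff.1 h1
  exact ⟨⟨p, q.1, g, hg, hp⟩, hp⟩

/-- The units of `eMe` act as permutations of `Q · e`. -/
theorem exists_actsAs (he : e * e = e) {g : SyntacticMonoid L} (hg : g ∈ localUnits e) :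
    ∃ π, ActsAs L (statesAct L (localUnits e)) g π := by
  obtain ⟨hg1, hg2, y, hy1, hy2, hgy, hyg⟩ := id hg
  have hy : y ∈ localUnits e := ⟨hy1, hy2, g, hg1, hg2, hyg, hgy⟩
  choose f hf using exists_act_eq_some he hg
  choose f' hf' using exists_act_eq_some he hy
  have hid := actsAs_idempotent he
  refine ⟨⟨f, f', fun q => ?_, fun q => ?_⟩, hf⟩
  · have h1 : act L q.1 (g * y) = some (f' (f q)).1 := act_mul_eq_some_iff.2 ⟨_, hf q, hf' _⟩
    rw [hgy] at h1
    exact Subtype.ext (Option.some_injective _ (h1.symm.trans (hid q)))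
  · have h1 : act L q.1 (y * g) = some (f (f' q)).1 := act_mul_eq_some_iff.2 ⟨_, hf' q, hf _⟩
    rw [hyg] at h1
    exact Subtype.ext (Option.some_injective _ (h1.symm.trans (hid q)))

/-- The permutations of `Q · e` induced by the units of `eMe` form a group. -/
def actionGroup (he : e * e = e) : Subgroup (Equiv.Perm (statesAct L (localUnits e))) where
  carrier := {π | ∃ g ∈ localUnits e, ActsAs L (statesAct L (localUnits e)) g π}
  one_mem' := ⟨e, ⟨he, he, e, he, he, he, he⟩, actsAs_idempotent he⟩
  mul_mem' := by
    rintro π ρ ⟨g, hg, hπ⟩ ⟨h, hh, hρ⟩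
    exact ⟨h * g, (isSubgroupOf_localUnits he).1 h hh g hg, hρ.mul hπ⟩
  inv_mem' := by
    rintro π ⟨g, ⟨hg1, hg2, y, hy1, hy2, hgy, hyg⟩, hπ⟩
    have hy : y ∈ localUnits e := ⟨hy1, hy2, g, hg1, hg2, hyg, hgy⟩
    obtain ⟨ρ, hρ⟩ := exists_actsAs he hy
    have h1 := hπ.mul hρ
    rw [hgy] at h1
    have h2 : ρ * π = 1 := h1.unique (actsAs_idempotent he)
    exact ⟨y, hy, eq_inv_of_mul_eq_one_left h2 ▸ hρ⟩

end ActsAs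

/-! ### The words of `F` and the `𝓛`-class of `K` -/

variable {F X : Set (FreeMonoid A)}

/-- This transfers the minimality of `J(F)` to the finite monoid, where it supplies the factor
relations required by stability. -/
theorem isFactor_etaHat_of_mem (hX : IsRationalCode X) {e : SyntacticMonoid (kleeneStar X)}
    (he : e ∈ JClassOf F hX) {v : FreeProfiniteMonoid A} (hv : v ∈ profiniteClosure F) :
    IsFactor (etaHat (kleeneStar X) hX.finite_syntacticMonoid_star v) e := by
  obtain ⟨w, hw, hew⟩ := he
  exact ((hw.2 v hv).map _).trans hew.isFactor

/-- First return words to `u` act on the `𝓛`-class of `u` like units of `eMe`. -/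
theorem mul_eta_mem_localUnits (hX : IsRationalCode X) {e : SyntacticMonoid (kleeneStar X)}
    (hee : e * e = e) (he : e ∈ JClassOf F hX) {u v : FreeMonoid A}
    (hue : GreenL (eta (kleeneStar X) u) e) (hv : v ∈ firstReturns F u) :
    e * eta (kleeneStar X) v ∈ localUnits e := by
  have := hX.finite_syntacticMonoid_star
  obtain ⟨-, huv, ⟨x, hx⟩, -⟩ := hv
  obtain ⟨s, hs⟩ := hue.exists_mul
  obtain ⟨t, ht⟩ := hue.symm.exists_mul
  have hx' : eta (kleeneStar X) u * eta (kleeneStar X) v =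
      eta (kleeneStar X) x * eta (kleeneStar X) u := by rw [← map_mul, hx, map_mul]
  have hfac : IsFactor (eta (kleeneStar X) x * eta (kleeneStar X) u) (eta (kleeneStar X) u) := by
    rw [← hx', ← map_mul]
    refine (isFactor_etaHat_of_mem hX he (ofWord_mem_profiniteClosure huv)).trans ?_
    exact hs ▸ isFactor_mul_left e s
  obtain ⟨y, hy⟩ := exists_eq_mul_of_isFactor hfac
  have hUe : eta (kleeneStar X) u * e = eta (kleeneStar X) u := by rw [hs, mul_assoc, hee]
  have hVe : e * eta (kleeneStar X) v = t * (eta (kleeneStar X) x * eta (kleeneStar X) u) := by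
    rw [← hx', ← mul_assoc, ← ht]
  -- Here `s` carries `e` to `η(u)`, `y` undoes the passage from `η(u)` to `η(uv)`, and `t` carries
  -- `η(u)` back to `e`.
  refine mem_localUnits_of_left_inverse (n := e * (t * y * s) * e) ?_ ?_ ?_ ?_ ?_
  · rw [← mul_assoc, hee]
  · rw [hVe, mul_assoc, mul_assoc, hUe]
  · rw [← mul_assoc, ← mul_assoc, hee]
  · rw [mul_assoc, hee]
  · calc e * (t * y * s) * e * (e * eta (kleeneStar X) v)
        = e * (t * (y * (s * (e * e) * eta (kleeneStar X) v))) := by simp only [mul_assoc]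
      _ = e := by rw [hee, ← hs, hx', ← hy, ← ht, hee]

/-- For a weakly charged code, every element of `K` is the image of an element `h` of a subgroup of
`J(F)` whose neutral element `z * u` ends with `u`. -/
theorem IsWeaklyCharged.exists_preimage (hF : IsRecurrent F) {hX : IsRationalCode X}
    (hXF : IsWeaklyCharged F hX) {e : SyntacticMonoid (kleeneStar X)} (hee : e * e = e)
    (he : e ∈ JClassOf F hX) {u : FreeMonoid A} (hu : u ∈ F)
    (hue : GreenL (eta (kleeneStar X) u) e) :
    ∃ z, z * ofWord u ∈ JClass F ∧ ∀ g ∈ localUnits e, ∃ h ∈ localUnits (z * ofWord u),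
      e * etaHat (kleeneStar X) hX.finite_syntacticMonoid_star h = g := by
  have := hX.finite_syntacticMonoid_star
  have hne : (JClass F).Nonempty := by
    obtain ⟨w, hw, -⟩ := he
    exact ⟨w, hw⟩
  obtain ⟨z, hz, hzz⟩ := hF.exists_idempotent_mul_ofWord hne hu
  set φ := etaHat (kleeneStar X) hX.finite_syntacticMonoid_star with hφ
  refine ⟨z, hz, ?_⟩
  set f := z * ofWord u with hf
  have hfmem : f ∈ localUnits f := ⟨hzz, hzz, f, hzz, hzz, hzz, hzz⟩
  have hφf : φ f * φ f = φ f := by rw [← map_mul, hzz]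
  have himage : φ '' localUnits f = localUnits (φ f) :=
    (hXF.2 _ (isMaximalSubgroup_localUnits hzz)
      (localUnits_subset_JClass hF.factorial hz)).1.eq_localUnits ⟨f, hfmem, rfl⟩ hφf
  have hφu : φ f = φ z * eta (kleeneStar X) u := by rw [hf, map_mul, hφ, etaHat_ofWord]
  obtain ⟨s, hs⟩ := hue.exists_mul
  obtain ⟨t, ht⟩ := hue.symm.exists_mul
  -- The idempotents `φ f` and `e` are `𝓛`-equivalent: `φ f` is a left multiple of `η(u)`, and
  -- stability gives the converse. Left multiplication by `φ f` then carries the units at `e` to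
  -- those at `φ f`, and left multiplication by `e` brings them back.
  have hfe : φ f * e = φ f := by rw [hφu, hs, mul_assoc, mul_assoc, hee]
  have hef : e * φ f = e := by
    obtain ⟨y, hy⟩ := exists_eq_mul_of_isFactor (s := eta (kleeneStar X) u) (x := φ z) (by
      rw [← hφu]
      exact (isFactor_etaHat_of_mem hX he hz.1).trans (hs ▸ isFactor_mul_left e s))
    rw [← hφu] at hy
    rw [ht, hy, mul_assoc, mul_assoc, hφf]
  intro g hg
  obtain ⟨hg1, hg2, y, hy1, hy2, hgy, hyg⟩ := hg
  have hgf : g * φ f = g := by rw [← hg2, mul_assoc, hef]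
  have hyf : y * φ f = y := by rw [← hy2, mul_assoc, hef]
  have hmem : φ f * g ∈ localUnits (φ f) := by
    refine ⟨by rw [← mul_assoc, hφf], by rw [mul_assoc, hgf], φ f * y, by rw [← mul_assoc, hφf],
      by rw [mul_assoc, hyf], ?_, ?_⟩
    · rw [mul_assoc, ← mul_assoc g, hgf, hgy, hfe]
    · rw [mul_assoc, ← mul_assoc y, hyf, hyg, hfe]
  rw [← himage] at hmem
  obtain ⟨h, hh, hhg⟩ := hmem
  exact ⟨h, hh, by rw [hhg, ← mul_assoc, hef, hg1]⟩

/-- A pseudoword `u * k * u` in the closure of `S` is approximated by words `u * k' * u` of `S`. -/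
theorem exists_mul_mul_mem_of_mem_profiniteClosure [Finite A] {S : Set (FreeMonoid A)}
    {u : FreeMonoid A} {k : FreeProfiniteMonoid A} (h : ofWord u * k * ofWord u ∈ profiniteClosure S)
    (c : FiniteCon A) :
    ∃ k' : FreeMonoid A, u * (k' * u) ∈ S ∧ proj A c (ofWord k') = proj A c k := by
  -- The length congruence forces the outer factors of the approximating word to be exactly `u`. In
  -- `c₁`, the part `c₀.factorization` allows the second cut and the part `c₀` identifies the first
  -- factor.
  let c₀ := c.inf (FiniteCon.length A u.length)
  let c₁ := c₀.factorization.inf c₀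
  have hc₀ : c₀.1 ≤ (FiniteCon.length A u.length).1 := inf_le_right
  obtain ⟨w, hw, hwk⟩ := mem_profiniteClosure_iff.1 h c₁.factorization
  rw [mul_assoc] at hwk
  obtain ⟨u', w', rfl, hu', hw'⟩ := exists_factorization hwk
  obtain ⟨k', u'', rfl, hk', hu''⟩ := exists_factorization
    (proj_eq_of_le (inf_le_left : c₁.1 ≤ c₀.factorization.1) hw')
  obtain rfl : u' = u := eq_of_proj_length_eq
    (proj_eq_of_le ((inf_le_right : c₁.1 ≤ c₀.1).trans hc₀) hu')
  obtain rfl : u'' = u' := eq_of_proj_length_eq (proj_eq_of_le hc₀ hu'')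
  exact ⟨k', hw, proj_eq_of_le (inf_le_left : c₀.1 ≤ c.1) hk'⟩

end WordCode

open WordCode

theorem propositionp {A : Type*} [Finite A] (F : Set (FreeMonoid A)) (hF : IsRecurrent F)
    (X : Set (FreeMonoid A)) (hX : IsRationalCode X) (hXF : IsWeaklyCharged F hX)
    (K : Set (SyntacticMonoid (kleeneStar X)))
    (hK : IsMaximalSubgroup K) (hKJ : K ⊆ JClassOf F hX)
    (u : FreeMonoid A) (hu : u ∈ F) (huK : ∀ g ∈ K, GreenL (eta (kleeneStar X) u) g) :
    (∀ v ∈ firstReturns F u, ∃ π : Equiv.Perm (statesAct (kleeneStar X) K),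
      ActsAs (kleeneStar X) (statesAct (kleeneStar X) K) (eta (kleeneStar X) v) π) ∧
    (∀ g ∈ K, ∃ π : Equiv.Perm (statesAct (kleeneStar X) K),
      ActsAs (kleeneStar X) (statesAct (kleeneStar X) K) g π) ∧
    (Subgroup.closure {π : Equiv.Perm (statesAct (kleeneStar X) K) |
        ∃ v ∈ firstReturns F u,
          ActsAs (kleeneStar X) (statesAct (kleeneStar X) K) (eta (kleeneStar X) v) π} :
      Set (Equiv.Perm (statesAct (kleeneStar X) K))) =
    {π : Equiv.Perm (statesAct (kleeneStar X) K) |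
      ∃ g ∈ K, ActsAs (kleeneStar X) (statesAct (kleeneStar X) K) g π} := by
  obtain ⟨-, e, heK, hid, -⟩ := hK.1
  have hee : e * e = e := (hid e heK).1
  have he : e ∈ JClassOf F hX := hKJ heK
  have hue := huK e heK
  obtain rfl := hK.eq_localUnits heK hee
  have hone := actsAs_idempotent hee
  have hret : ∀ v ∈ firstReturns F u, e * eta (kleeneStar X) v ∈ localUnits e := fun v hv =>
    mul_eta_mem_localUnits hX hee he hue hv
  have hact : ∀ v ∈ firstReturns F u, ∃ π,
      ActsAs (kleeneStar X) (statesAct (kleeneStar X) (localUnits e)) (eta (kleeneStar X) v) π := by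
    intro v hv
    obtain ⟨π, hπ⟩ := exists_actsAs hee (hret v hv)
    exact ⟨π, hone.of_mul_left hπ⟩
  refine ⟨hact, fun g hg => exists_actsAs hee hg, Set.Subset.antisymm ?_ ?_⟩
  · have : Subgroup.closure {π | ∃ v ∈ firstReturns F u, ActsAs (kleeneStar X)
        (statesAct (kleeneStar X) (localUnits e)) (eta (kleeneStar X) v) π} ≤ actionGroup hee := by
      refine (Subgroup.closure_le _).2 ?_
      rintro π ⟨v, hv, hπ⟩
      exact ⟨_, hret v hv, mul_one π ▸ hone.mul hπ⟩
    exact this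
  · rintro π ⟨g, hg, hπ⟩
    obtain ⟨z, hz, hzg⟩ := hXF.exists_preimage hF hee he hu hue
    obtain ⟨h, hh, rfl⟩ := hzg g hg
    have hfac : IsFactor (ofWord u * (h * z) * ofWord u) (z * ofWord u) := by
      obtain ⟨h1, h2, y, -, -, -, hyh⟩ := hh
      refine ⟨y * z, 1, ?_⟩
      calc z * ofWord u = y * (z * ofWord u * h * (z * ofWord u)) := by rw [h1, h2, hyh]
        _ = _ := by simp only [mul_assoc, mul_one]
    obtain ⟨k, hk, hkh⟩ := exists_mul_mul_mem_of_mem_profiniteClosure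
      (hF.factorial.mem_profiniteClosure hfac hz.1)
      ⟨syntacticCon (kleeneStar X), hX.finite_syntacticMonoid_star⟩
    have hmem := mem_closure_firstReturns hF.factorial (k * u) hk ⟨u * k, (mul_assoc _ _ _).symm⟩
    -- The unit `h` satisfies `h * (z * u) = h`, so the final `u` of `k * u` completes `h * z` to
    -- `h`.
    have heta : eta (kleeneStar X) (k * u) =
        etaHat (kleeneStar X) hX.finite_syntacticMonoid_star h := by
      have h1 : eta (kleeneStar X) k =
        etaHat (kleeneStar X) hX.finite_syntacticMonoid_star (h * z) := hkh
      rw [map_mul, h1, ← etaHat_ofWord _ hX.finite_syntacticMonoid_star, ← map_mul, mul_assoc,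
        hh.2.1]
    have hsub : ∀ w ∈ Submonoid.closure (firstReturns F u), ∃ ρ ∈ Subgroup.closure {π |
        ∃ v ∈ firstReturns F u, ActsAs (kleeneStar X)
          (statesAct (kleeneStar X) (localUnits e)) (eta (kleeneStar X) v) π},
        ActsAs (kleeneStar X) (statesAct (kleeneStar X) (localUnits e))
          (eta (kleeneStar X) w) ρ := by
      intro w hw
      induction hw using Submonoid.closure_induction with
      | mem v hv =>
        obtain ⟨ρ, hρ⟩ := hact v hv
        exact ⟨ρ, Subgroup.subset_closure ⟨v, hv, hρ⟩, hρ⟩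
      | one => exact ⟨1, Subgroup.one_mem _, by rw [map_one]; exact ActsAs.one⟩
      | mul v w _ _ hv hw =>
        obtain ⟨ρ, hρ, hv⟩ := hv
        obtain ⟨σ, hσ, hw⟩ := hw
        exact ⟨σ * ρ, Subgroup.mul_mem _ hσ hρ, by rw [map_mul]; exact hv.mul hw⟩
    obtain ⟨ρ, hρ, hact'⟩ := hsub _ hmem
    rw [heta] at hact'
    -- Since `e` acts trivially, the image of `h` acts as `π`; it equals `η(ku)`, which acts as `ρ`.
    obtain rfl : π = ρ := (hone.of_mul_left hπ).unique hact'
    exact hρ
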